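/- Let $G=(V,E)$ be a locally finite connected simple graph (finite or infinite), and consider Bernoulli bond percolation on $G$: the edges $e\in E$ are open independently of each other, with probabilities $p_e\in[0,1]$. The clusters are the connected components of the graph formed by the open edges. For distinct vertices $a,b,c\in V$, let $\mathbf P(abc)$ be the probability that $a$, $b$ and $c$ are in the same cluster, $\mathbf P(a|b|c)$ the probability that they are in three different clusters, and, for $\{x,y,z\}=\{a,b,c\}$, let $\mathbf P(xy|z)$ be the probability that $x$ and $y$ are in the same cluster, different from the cluster of $z$. Theorem. For every $\varepsilon>0$ there is a $\delta>0$, depending only on $\varepsilon$ (and neither on $G$, nor on the edge probabilities, nor on the vertices), such that for all $G$, all $(p_e)_{e\in E}$ and all distinct vertices $a,b,c$ as above, $$\Big[\mathbf P(ab|c)<\delta \text{ and } \mathbf P(ac|b)<\delta\Big] \implies \Big[\mathbf P(abc)<\varepsilon \text{ or } \mathbf P(a|b|c)<\varepsilon\Big].$$ Moreover, one can take $\delta=\varepsilon^3/4$. -/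

import Mathlib

namespace Percolation

open MeasureTheory ProbabilityTheory

variable {V : Type*}

/-- A bond percolation configuration on `G`: each edge is open (`true`) or closed (`false`). -/
abbrev Configuration (G : SimpleGraph V) : Type _ := G.edgeSet → Bool

/-- Bernoulli bond percolation on `G`: the edges are open independently of each other, and the
edge `e` is open with probability `p e`. -/
noncomputable def bernoulliPercolation (G : SimpleGraph V) (p : G.edgeSet → unitInterval) :
    Measure (Configuration G) :=
  Measure.infinitePi fun e => bernoulliMeasure true false (p e)

/-- The subgraph, on all the vertices of `G`, that is formed by the open edges. -/
def openGraph (G : SimpleGraph V) (C : Configuration G) : SimpleGraph V :=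
  SimpleGraph.fromEdgeSet {e | ∃ h : e ∈ G.edgeSet, C ⟨e, h⟩ = true}

/-- The percolation cluster of `v`: its connected component in the graph of open edges. -/
def cluster (G : SimpleGraph V) (C : Configuration G) (v : V) :
    (openGraph G C).ConnectedComponent :=
  (openGraph G C).connectedComponentMk v

/-- The event `abc`: the three vertices are in the same cluster. -/
def allTogether (G : SimpleGraph V) (a b c : V) : Set (Configuration G) :=
  {C | cluster G C a = cluster G C b ∧ cluster G C b = cluster G C c}

/-- The event `a|b|c`: the three vertices are in three different clusters. -/
def allSeparate (G : SimpleGraph V) (a b c : V) : Set (Configuration G) :=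
  {C | cluster G C a ≠ cluster G C b ∧ cluster G C a ≠ cluster G C c ∧
    cluster G C b ≠ cluster G C c}

/-- The event `xy|z`: the vertices `x` and `y` are in the same cluster, and the cluster of `z` is
a different one. -/
def pairApart (G : SimpleGraph V) (x y z : V) : Set (Configuration G) :=
  {C | cluster G C x = cluster G C y ∧ cluster G C x ≠ cluster G C z}

end Percolation

/-! On a finite graph, explore the cluster of `a` edge by edge. Let `A` be the set of vertices found
so far, `M` the conditional probability of `a|b|c`, and `W` that of `b` and `c` not being connected
off `A`. Initially `W ≥ M ≥ ε`. Revealing an edge that leaves `A` does not affect connections off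
`A`, and enlarging `A` only destroys some, so `W ≥ ε` persists. Stop when `M` drops below `ε/2`.
Closing an edge cannot lower `M`. Opening one turns `a|b|c` only into `ab|c` or `ac|b`, so at the
stop `M + P(ab|c) + P(ac|b) ≥ ε/2` still holds.

At the stop `W` exceeds `M` by more than `ε/2`, and this forces `ab|c` or `ac|b` to have some
probability. Indeed `W ≤ M + P(ab|c) + t`, where `t` is the probability that `a` and `c` are
connected while `b` and `c` are not connected off `A`. The core estimate
`prob_mul_prob_le_prob_pair` bounds `t` through `(M + P(ac|b)) t ≤ P(ac|b)`: given the cluster `B`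
of `b` off `A`, the remaining edges are fresh, both "b is isolated from a and c" and the chance of
joining `a` to `c` off `B` decrease in the configuration, and Harris applies. Together with the same
bound for `b` and `c` exchanged, elementary algebra gives `P(ab|c) + P(ac|b) ≥ (ε²/2)(1 - M)` at the
stop.

Without a stop, the exploration ends with a cluster of `a` that misses `b` and `c`. Averaging over
the exploration, `P(ab|c) + P(ac|b)` is at least `ε²/2` times the probability that `a` is joined to
`b` or `c`, hence at least `ε³/2` if `P(abc) ≥ ε`. Infinite graphs follow by exhaustion with finite
edge sets. -/

namespace Percolation

/-! ### Finite product measures: conditioning on an edge, Harris inequality, resampling. -/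

section FiniteProduct

variable {E : Type*}

/-- The configuration that agrees with `C` on `S` and with `C'` off `S`. -/
noncomputable def hybrid (S : Set E) (C C' : E → Bool) : E → Bool :=
  open Classical in fun e => if e ∈ S then C e else C' e

theorem hybrid_of_mem {S : Set E} {e : E} (h : e ∈ S) (C C' : E → Bool) :
    hybrid S C C' e = C e := by
  simp [hybrid, h]

theorem hybrid_of_notMem {S : Set E} {e : E} (h : e ∉ S) (C C' : E → Bool) :
    hybrid S C C' e = C' e := by
  simp [hybrid, h]

theorem update_mem_Icc [DecidableEq E] {p : E → ℝ} (hp : ∀ e, 0 ≤ p e ∧ p e ≤ 1) (e : E)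
    {x : ℝ} (hx : 0 ≤ x ∧ x ≤ 1) (i : E) :
    0 ≤ Function.update p e x i ∧ Function.update p e x i ≤ 1 := by
  by_cases hi : i = e
  · subst hi
    simpa using hx
  · simpa [Function.update_of_ne hi] using hp i

variable [Fintype E]

/-- The probability of the configuration `C` when the edges are open independently of each other,
the edge `e` with probability `p e`. -/
noncomputable def weight (p : E → ℝ) (C : E → Bool) : ℝ :=
  ∏ e, if C e = true then p e else 1 - p e

/-- The expectation of `f` in the finite product model with edge probabilities `p`. -/
noncomputable def expect [DecidableEq E] (p : E → ℝ) (f : (E → Bool) → ℝ) : ℝ :=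
  ∑ C, weight p C * f C

open Classical in
/-- The probability of an event in the finite product model with edge probabilities `p`. -/
noncomputable def prob [DecidableEq E] (p : E → ℝ) (P : (E → Bool) → Prop) : ℝ :=
  expect p fun C => if P C then 1 else 0

variable {p : E → ℝ}

theorem weight_nonneg (hp : ∀ e, 0 ≤ p e ∧ p e ≤ 1) (C : E → Bool) : 0 ≤ weight p C := by
  refine Finset.prod_nonneg fun e _ => ?_
  split_ifs
  · exact (hp e).1
  · linarith [(hp e).2]

theorem open_of_weight_ne_zero {C : E → Bool} (h : weight p C ≠ 0) {e : E} (he : p e = 1) :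
    C e = true := by
  by_contra hC
  exact h (Finset.prod_eq_zero (Finset.mem_univ e) (by simp [hC, he]))

theorem closed_of_weight_ne_zero {C : E → Bool} (h : weight p C ≠ 0) {e : E} (he : p e = 0) :
    C e = false := by
  by_contra hC
  exact h (Finset.prod_eq_zero (Finset.mem_univ e) (by simp [hC, he]))

variable [DecidableEq E]

theorem sum_weight (p : E → ℝ) : ∑ C, weight p C = 1 := by
  have := Finset.prod_univ_sum (fun _ : E => (Finset.univ : Finset Bool))
    (fun e b => if b = true then p e else 1 - p e)
  simp only [Fintype.piFinset_univ] at this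
  simp only [weight]
  rw [← this]
  simp

theorem expect_mono (hp : ∀ e, 0 ≤ p e ∧ p e ≤ 1) {f g : (E → Bool) → ℝ}
    (h : ∀ C, weight p C ≠ 0 → f C ≤ g C) : expect p f ≤ expect p g := by
  refine Finset.sum_le_sum fun C _ => ?_
  by_cases hC : weight p C = 0
  · simp [hC]
  · exact mul_le_mul_of_nonneg_left (h C hC) (weight_nonneg hp C)

theorem expect_add (p : E → ℝ) (f g : (E → Bool) → ℝ) :
    expect p (fun C => f C + g C) = expect p f + expect p g := by
  simp only [expect, mul_add, Finset.sum_add_distrib]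

theorem expect_const (p : E → ℝ) (c : ℝ) : expect p (fun _ => c) = c := by
  simp only [expect, ← Finset.sum_mul, sum_weight, one_mul]

theorem prob_nonneg (hp : ∀ e, 0 ≤ p e ∧ p e ≤ 1) (P : (E → Bool) → Prop) : 0 ≤ prob p P :=
  Finset.sum_nonneg fun C _ =>
    mul_nonneg (weight_nonneg hp C) (by dsimp only; split_ifs <;> norm_num)

theorem prob_le_one (hp : ∀ e, 0 ≤ p e ∧ p e ≤ 1) (P : (E → Bool) → Prop) : prob p P ≤ 1 := by
  rw [← expect_const p 1]
  exact expect_mono hp fun C _ => by split_ifs <;> norm_num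

theorem prob_mono (hp : ∀ e, 0 ≤ p e ∧ p e ≤ 1) {P Q : (E → Bool) → Prop}
    (h : ∀ C, weight p C ≠ 0 → P C → Q C) : prob p P ≤ prob p Q := by
  refine expect_mono hp fun C hC => ?_
  have := h C hC
  split_ifs <;> first | tauto | norm_num

theorem prob_le_add (hp : ∀ e, 0 ≤ p e ∧ p e ≤ 1) {P Q R : (E → Bool) → Prop}
    (h : ∀ C, weight p C ≠ 0 → P C → Q C ∨ R C) : prob p P ≤ prob p Q + prob p R := by
  rw [prob, prob, prob, ← expect_add]
  refine expect_mono hp fun C hC => ?_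
  have := h C hC
  split_ifs <;> first | tauto | norm_num

theorem prob_add_le (hp : ∀ e, 0 ≤ p e ∧ p e ≤ 1) {P Q R : (E → Bool) → Prop}
    (hQ : ∀ C, weight p C ≠ 0 → Q C → P C) (hR : ∀ C, weight p C ≠ 0 → R C → P C)
    (h : ∀ C, weight p C ≠ 0 → Q C → ¬ R C) : prob p Q + prob p R ≤ prob p P := by
  rw [prob, prob, prob, ← expect_add]
  refine expect_mono hp fun C hC => ?_
  have := h C hC
  have := hQ C hC
  have := hR C hC
  split_ifs <;> first | tauto | norm_num

/-- Conditioning on the state of one edge. -/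
theorem expect_eq_update (p : E → ℝ) (e : E) (f : (E → Bool) → ℝ) :
    expect p f = p e * expect (Function.update p e 1) f +
      (1 - p e) * expect (Function.update p e 0) f := by
  simp only [expect, Finset.mul_sum, ← Finset.sum_add_distrib]
  refine Finset.sum_congr rfl fun C _ => ?_
  have key : weight p C = p e * weight (Function.update p e 1) C +
      (1 - p e) * weight (Function.update p e 0) C := by
    have h : ∀ x, weight (Function.update p e x) C = (if C e = true then x else 1 - x) *
        ∏ i ∈ Finset.univ.erase e, if C i = true then p i else 1 - p i := by
      intro x
      rw [weight, ← Finset.mul_prod_erase _ _ (Finset.mem_univ e)]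
      congr 1
      · simp
      · refine Finset.prod_congr rfl fun i hi => ?_
        rw [Function.update_of_ne (Finset.ne_of_mem_erase hi)]
    have h' := h (p e)
    rw [Function.update_eq_self] at h'
    rw [h, h, h']
    split_ifs <;> ring
  rw [key]
  ring

theorem prob_eq_update (p : E → ℝ) (e : E) (P : (E → Bool) → Prop) :
    prob p P = p e * prob (Function.update p e 1) P +
      (1 - p e) * prob (Function.update p e 0) P :=
  expect_eq_update p e _

/-- Flipping the state of `e` is a bijection that carries one law to the other. It couples the
models with `e` closed and `e` open. -/
theorem expect_update_zero (p : E → ℝ) (e : E) (f : (E → Bool) → ℝ) :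
    expect (Function.update p e 0) f =
      expect (Function.update p e 1) fun C => f (Function.update C e (!C e)) := by
  have hinv : Function.Involutive fun C : E → Bool => Function.update C e (!C e) := by
    intro C
    simp
  simp only [expect]
  rw [← Equiv.sum_comp hinv.toPerm]
  refine Finset.sum_congr rfl fun C _ => ?_
  simp only [Function.Involutive.coe_toPerm]
  congr 1
  refine Finset.prod_congr rfl fun i _ => ?_
  by_cases hi : i = e
  · subst hi
    cases C i <;> simp
  · simp [Function.update_of_ne hi]

/-- The Harris inequality for two decreasing functions. -/
theorem expect_mul_expect_le_of_antitone (hp : ∀ e, 0 ≤ p e ∧ p e ≤ 1) {f g : (E → Bool) → ℝ}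
    (hf₀ : 0 ≤ f) (hg₀ : 0 ≤ g) (hf : Antitone f) (hg : Antitone g) :
    expect p f * expect p g ≤ expect p fun C => f C * g C := by
  -- The order is reversed to make the functions increasing; the lattice condition holds with
  -- equality for product weights.
  have := fkg (α := (E → Bool)ᵒᵈ) (μ := fun C => weight p (OrderDual.ofDual C))
    (f := fun C => f (OrderDual.ofDual C)) (g := fun C => g (OrderDual.ofDual C))
    (fun C => weight_nonneg hp _) (fun C => hf₀ _) (fun C => hg₀ _)
    (fun C C' h => hf h) (fun C C' h => hg h) (fun C C' => by
      simp only [weight, ← Finset.prod_mul_distrib]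
      refine le_of_eq (Finset.prod_congr rfl fun e _ => ?_)
      rw [ofDual_inf, ofDual_sup, Pi.sup_apply, Pi.inf_apply]
      rcases Bool.eq_false_or_eq_true (OrderDual.ofDual C e) with h | h <;>
        rcases Bool.eq_false_or_eq_true (OrderDual.ofDual C' e) with h' | h' <;>
          simp [h, h', mul_comm])
  have h1 : ∑ C : (E → Bool)ᵒᵈ, weight p (OrderDual.ofDual C) = 1 := sum_weight p
  rw [h1, one_mul] at this
  exact this

/-- If the set `S C` is revealed by looking at `C` on `S C` only, then resampling the edges off
`S C` does not change the law of the configuration. -/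
theorem expect_expect_hybrid (p : E → ℝ) {S : (E → Bool) → Set E}
    (hS : ∀ C C', (∀ e ∈ S C, C e = C' e) → S C' = S C) (f : (E → Bool) → ℝ) :
    (expect p fun C => expect p fun C' => f (hybrid (S C) C C')) = expect p f := by
  -- Exchange the two configurations off `S C`. Since `S C` survives the exchange, this is an
  -- involution, and it preserves the product weight.
  let σ : (E → Bool) × (E → Bool) → (E → Bool) × (E → Bool) := fun x =>
    (hybrid (S x.1) x.1 x.2, hybrid (S x.1) x.2 x.1)
  have hS' : ∀ C C', S (hybrid (S C) C C') = S C := fun C C' =>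
    hS C _ fun e he => (hybrid_of_mem he _ _).symm
  have hσ : Function.Involutive σ := by
    rintro ⟨C, C'⟩
    simp only [σ, hS']
    ext e <;> by_cases he : e ∈ S C <;> simp [hybrid, he]
  have hw : ∀ x, weight p (σ x).1 * weight p (σ x).2 = weight p x.1 * weight p x.2 := by
    rintro ⟨C, C'⟩
    simp only [weight, ← Finset.prod_mul_distrib, σ]
    refine Finset.prod_congr rfl fun e _ => ?_
    by_cases he : e ∈ S C <;> simp [hybrid, he, mul_comm]
  calc (expect p fun C => expect p fun C' => f (hybrid (S C) C C'))
      = ∑ x : (E → Bool) × (E → Bool), weight p x.1 * weight p x.2 * f (σ x).1 := by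
        rw [Fintype.sum_prod_type]
        simp only [expect, Finset.mul_sum, σ, mul_assoc]
    _ = ∑ x : (E → Bool) × (E → Bool), weight p x.1 * weight p x.2 * f x.1 := by
        rw [← Equiv.sum_comp hσ.toPerm]
        refine Finset.sum_congr rfl fun x _ => ?_
        simp only [Function.Involutive.coe_toPerm, hw, hσ x]
    _ = expect p f := by
        rw [Fintype.sum_prod_type]
        simp only [expect]
        refine Finset.sum_congr rfl fun C _ => ?_
        rw [← Finset.sum_mul, ← Finset.mul_sum, sum_weight, mul_one]

end FiniteProduct

end Percolation
namespace Percolation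

/-! ### Connections off a set, and the correlation estimate. -/

section Connection

variable {V E : Type*} {r : E → Sym2 V} {C C' : E → Bool} {X Y A : Set V} {u v w a b c : V}

/-- The vertices `u` and `v`, neither of them in `X`, are the ends of an open edge. -/
def OpenStep (r : E → Sym2 V) (C : E → Bool) (X : Set V) (u v : V) : Prop :=
  u ∉ X ∧ v ∉ X ∧ ∃ e, C e = true ∧ r e = s(u, v)

/-- The vertices `u` and `v` are connected by an open path that avoids `X`. -/
def ConnOff (r : E → Sym2 V) (C : E → Bool) (X : Set V) : V → V → Prop :=
  Relation.ReflTransGen (OpenStep r C X)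

theorem ConnOff.mono (h : ConnOff r C X u v) (hC : C ≤ C') (hX : Y ⊆ X) : ConnOff r C' Y u v :=
  Relation.ReflTransGen.mono (fun _ _ ⟨h1, h2, e, he, hr⟩ =>
    ⟨fun h => h1 (hX h), fun h => h2 (hX h), e, hC e he, hr⟩) _ _ h

theorem ConnOff.full (h : ConnOff r C X u v) : ConnOff r C ∅ u v :=
  h.mono le_rfl (Set.empty_subset X)

theorem ConnOff.symm (h : ConnOff r C X u v) : ConnOff r C X v u := by
  induction h with
  | refl => exact Relation.ReflTransGen.refl
  | tail _ h ih =>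
    obtain ⟨h1, h2, e, he, hr⟩ := h
    exact ih.head ⟨h2, h1, e, he, hr.trans Sym2.eq_swap⟩

theorem ConnOff.trans (h : ConnOff r C X u v) (h' : ConnOff r C X v w) : ConnOff r C X u w :=
  Relation.ReflTransGen.trans h h'

theorem ConnOff.notMem (h : ConnOff r C X u v) (hu : u ∉ X) : v ∉ X := by
  induction h with
  | refl => exact hu
  | tail _ h => exact h.2.1

/-- An open path from outside of `A` either avoids `A` or has a first vertex in `A`; up to there
it avoids every part of the complement of `A` that is not connected to `u` off `A`. -/
theorem ConnOff.off_or_exists_mem (h : ConnOff r C ∅ u v) (hu : u ∉ A) (hXA : ∀ x ∈ X, x ∉ A)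
    (hX : ∀ x ∈ X, ¬ ConnOff r C A u x) :
    ConnOff r C A u v ∨ ∃ y ∈ A, ConnOff r C X u y := by
  -- The induction has to carry both avoidances: the one of `A` keeps the path out of `X`, and the
  -- one of `X` is what the second alternative needs.
  suffices H : (ConnOff r C A u v ∧ ConnOff r C X u v) ∨ ∃ y ∈ A, ConnOff r C X u y from
    H.imp_left And.left
  induction h with
  | refl => exact Or.inl ⟨Relation.ReflTransGen.refl, Relation.ReflTransGen.refl⟩
  | @tail y z _ hyz ih =>
    rcases ih with ⟨h1, h2⟩ | h
    · have hyX : y ∉ X := fun hy => hX y hy h1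
      obtain ⟨-, -, e, he, hr⟩ := hyz
      by_cases hz : z ∈ A
      · exact Or.inr ⟨z, hz, h2.tail ⟨hyX, fun hzX => hXA z hzX hz, e, he, hr⟩⟩
      · have h3 : ConnOff r C A u z := h1.tail ⟨h1.notMem hu, hz, e, he, hr⟩
        exact Or.inl ⟨h3, h2.tail ⟨hyX, fun hzX => hX z hzX h3, e, he, hr⟩⟩
    · exact Or.inr h

/-- The edges with an end in `B`. -/
def touching (r : E → Sym2 V) (B : Set V) : Set E := {e | ∃ x ∈ B, x ∈ r e}

/-- The cluster of `b` off `A` is determined by the edges that touch it. -/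
theorem setOf_connOff_eq_of_agree
    (h : ∀ e ∈ touching r {v | ConnOff r C A b v}, C e = C' e) :
    {v | ConnOff r C' A b v} = {v | ConnOff r C A b v} := by
  ext z
  constructor
  · intro hz
    change ConnOff r C' A b z at hz
    change ConnOff r C A b z
    induction hz with
    | refl => exact Relation.ReflTransGen.refl
    | @tail y z _ hyz ih =>
      obtain ⟨h1, h2, e, he, hr⟩ := hyz
      exact ih.tail ⟨h1, h2, e, (h e ⟨y, ih, by simp [hr]⟩).trans he, hr⟩
  · intro hz
    change ConnOff r C A b z at hz
    change ConnOff r C' A b z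
    induction hz with
    | refl => exact Relation.ReflTransGen.refl
    | @tail y z hy hyz ih =>
      obtain ⟨h1, h2, e, he, hr⟩ := hyz
      exact ih.tail ⟨h1, h2, e, (h e ⟨y, hy, by simp [hr]⟩).symm.trans he, hr⟩

/-- The three vertices are in different clusters. -/
def Separate (r : E → Sym2 V) (a b c : V) (C : E → Bool) : Prop :=
  ¬ ConnOff r C ∅ a b ∧ ¬ ConnOff r C ∅ a c ∧ ¬ ConnOff r C ∅ b c

/-- The vertices `x` and `y` are connected to each other, and not to `z`. -/
def Pair (r : E → Sym2 V) (x y z : V) (C : E → Bool) : Prop :=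
  ConnOff r C ∅ x y ∧ ¬ ConnOff r C ∅ x z

variable [Fintype E] [DecidableEq E] {p : E → ℝ}

/-- If the cluster of `a` contains `A`, then paths from `a` to `c` that avoid the cluster of `b`
off `A` are no more likely than such paths given that `b` is isolated from `a` and `c`. -/
theorem prob_mul_prob_le_prob_pair (hp : ∀ e, 0 ≤ p e ∧ p e ≤ 1) (haA : a ∈ A) (hbA : b ∉ A)
    (hcA : c ∉ A) (hA : ∀ C, weight p C ≠ 0 → ∀ v ∈ A, ConnOff r C Aᶜ a v) :
    prob p (fun C => ¬ ConnOff r C ∅ a b ∧ ¬ ConnOff r C ∅ b c) *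
      prob p (fun C => ¬ ConnOff r C A b c ∧ ConnOff r C ∅ a c) ≤ prob p (Pair r a c b) := by
  classical
  let B : (E → Bool) → Set V := fun C => {v | ConnOff r C A b v}
  let S : (E → Bool) → Set E := fun C => touching r (B C)
  let I : (E → Bool) → Prop := fun C => ¬ ConnOff r C ∅ a b ∧ ¬ ConnOff r C ∅ b c
  have hBS : ∀ C C', (∀ e ∈ S C, C e = C' e) → B C' = B C := fun C C' h =>
    setOf_connOff_eq_of_agree h
  have hS : ∀ C C', (∀ e ∈ S C, C e = C' e) → S C' = S C := fun C C' h => by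
    simp only [S, hBS C C' h]
  have hBA : ∀ C, ∀ x ∈ B C, x ∉ A := fun C x hx => ConnOff.notMem hx hbA
  let f : (E → Bool) → ℝ := fun C => @ite _ (I C) (Classical.propDecidable _) 1 0
  -- The chance that fresh edges join `a` to `c` off the revealed cluster `B C`, set to zero if `c`
  -- lies in it. It decreases in `C` because `B C` grows with `C`.
  let g : (E → Bool) → ℝ := fun C =>
    prob p fun C' => ¬ ConnOff r C A b c ∧ ConnOff r C' (B C) a c
  have harris : prob p I * expect p g ≤ expect p fun C => f C * g C := by
    refine expect_mul_expect_le_of_antitone (f := f) (g := g) hp (fun C => ?_)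
      (fun C => prob_nonneg hp _) ?_ ?_
    · simp only [f, Pi.zero_apply]
      split_ifs <;> norm_num
    · intro C C' hC
      simp only [f]
      have : I C' → I C := fun ⟨h1, h2⟩ =>
        ⟨fun h => h1 (h.mono hC le_rfl), fun h => h2 (h.mono hC le_rfl)⟩
      split_ifs <;> first | tauto | norm_num
    · intro C C' hC
      refine prob_mono hp fun D _ ⟨h1, h2⟩ => ⟨fun h => h1 (h.mono hC le_rfl), ?_⟩
      exact h2.mono le_rfl fun v (hv : ConnOff r C A b v) => hv.mono hC le_rfl
  -- If `c` is not in `B C`, a path from `c` to `a` avoids `B C` until it first meets `A`, and from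
  -- there one can continue to `a` inside `A`. So the path can be taken off `B C`, where the edges
  -- may be resampled.
  have lower : prob p (fun C => ¬ ConnOff r C A b c ∧ ConnOff r C ∅ a c) ≤ expect p g := by
    have hle : prob p (fun C => ¬ ConnOff r C A b c ∧ ConnOff r C ∅ a c) ≤
        prob p fun C => ¬ ConnOff r C A b c ∧ ConnOff r C (B C) a c := by
      refine prob_mono hp fun C hC ⟨h1, h2⟩ => ⟨h1, ?_⟩
      rcases h2.symm.off_or_exists_mem hcA (hBA C)
        (fun x hx h => h1 (ConnOff.trans hx h.symm)) with h | ⟨y, hy, h⟩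
      · exact absurd haA (h.notMem hcA)
      · exact ((hA C hC y hy).mono le_rfl fun x hx => hBA C x hx).trans h.symm
    refine hle.trans ?_
    rw [prob, ← expect_expect_hybrid p hS]
    refine expect_mono hp fun C _ => expect_mono hp fun C' _ => ?_
    have hB := hBS C (hybrid (S C) C C') fun e he => (hybrid_of_mem he _ _).symm
    have : (¬ ConnOff r (hybrid (S C) C C') A b c ∧
        ConnOff r (hybrid (S C) C C') (B (hybrid (S C) C C')) a c) →
        (¬ ConnOff r C A b c ∧ ConnOff r C' (B C) a c) := by
      rintro ⟨h1, h2⟩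
      rw [hB] at h2
      refine ⟨fun h => h1 ?_, ?_⟩
      · have : c ∈ B (hybrid (S C) C C') := by rw [hB]; exact h
        exact this
      · refine Relation.ReflTransGen.mono ?_ _ _ h2
        rintro x y ⟨hx, hy, e, he, hr⟩
        refine ⟨hx, hy, e, ?_, hr⟩
        rwa [hybrid_of_notMem] at he
        rintro ⟨z, hz, hze⟩
        rw [hr, Sym2.mem_iff] at hze
        rcases hze with rfl | rfl
        · exact hx hz
        · exact hy hz
    split_ifs <;> first | tauto | norm_num
  have upper : (expect p fun C => f C * g C) ≤ prob p (Pair r a c b) := by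
    rw [prob, ← expect_expect_hybrid p hS fun C => if Pair r a c b C then 1 else 0]
    refine expect_mono hp fun C hC => ?_
    by_cases hI : I C
    · simp only [f, if_pos hI, one_mul]
      refine expect_mono hp fun C' _ => ?_
      have : (¬ ConnOff r C A b c ∧ ConnOff r C' (B C) a c) →
          Pair r a c b (hybrid (S C) C C') := by
        rintro ⟨-, h2⟩
        -- On `I C`, the set `B C` is the whole cluster of `b`: a path leaving it would enter `A`,
        -- hence join `b` to `a`. The resampled edges do not touch `B C`, so this remains true in
        -- the hybrid.
        have hfull : ∀ w, ConnOff r (hybrid (S C) C C') ∅ b w → ConnOff r C A b w := by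
          intro w hw
          induction hw with
          | refl => exact Relation.ReflTransGen.refl
          | @tail y z _ hyz ih =>
            obtain ⟨-, -, e, he, hr⟩ := hyz
            have heS : e ∈ S C := ⟨y, ih, by simp [hr]⟩
            rw [hybrid_of_mem heS] at he
            have hz : z ∉ A := fun hz => hI.1 <| (hA C hC z hz).full.trans
              (ConnOff.symm (ih.full.tail ⟨id, id, e, he, hr⟩))
            exact ih.tail ⟨ih.notMem hbA, hz, e, he, hr⟩
        refine ⟨?_, fun h => (hfull a h.symm).notMem hbA haA⟩
        refine ConnOff.full (X := B C) (Relation.ReflTransGen.mono ?_ _ _ h2)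
        rintro x y ⟨hx, hy, e, he, hr⟩
        refine ⟨hx, hy, e, ?_, hr⟩
        rwa [hybrid_of_notMem]
        rintro ⟨z, hz, hze⟩
        rw [hr, Sym2.mem_iff] at hze
        rcases hze with rfl | rfl
        · exact hx hz
        · exact hy hz
      split_ifs <;> first | tauto | norm_num
    · simp only [f, if_neg hI, zero_mul]
      exact prob_nonneg hp fun C' => Pair r a c b (hybrid (S C) C C')
  calc _ ≤ prob p I * expect p g := mul_le_mul_of_nonneg_left lower (prob_nonneg hp _)
    _ ≤ _ := harris.trans upper

/-- If the cluster of `a` contains `A`, then a disconnection of `b` and `c` off `A` comes,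
up to a small error `t`, from `a|b|c` or `ab|c`. -/
theorem exists_prob_not_connOff_le (hp : ∀ e, 0 ≤ p e ∧ p e ≤ 1) (haA : a ∈ A) (hbA : b ∉ A)
    (hcA : c ∉ A) (hA : ∀ C, weight p C ≠ 0 → ∀ v ∈ A, ConnOff r C Aᶜ a v) :
    ∃ t, prob p (fun C => ¬ ConnOff r C A b c) ≤
        prob p (Separate r a b c) + prob p (Pair r a b c) + t ∧
      (prob p (Separate r a b c) + prob p (Pair r a c b)) * t ≤ prob p (Pair r a c b) := by
  -- If `a` and `c` are not connected, a path from `b` to `c` that meets `A` would put `b` in the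
  -- cluster of `a`, leaving only `a|b|c` and `ab|c`. The error `t` is the remaining case.
  refine ⟨prob p (fun C => ¬ ConnOff r C A b c ∧ ConnOff r C ∅ a c), ?_, ?_⟩
  · have h1 : prob p (fun C => ¬ ConnOff r C A b c) ≤
        prob p (fun C => Separate r a b c C ∨ Pair r a b c C) +
          prob p (fun C => ¬ ConnOff r C A b c ∧ ConnOff r C ∅ a c) := by
      refine prob_le_add hp fun C hC h => ?_
      by_cases hac : ConnOff r C ∅ a c
      · exact Or.inr ⟨h, hac⟩
      · by_cases hab : ConnOff r C ∅ a b
        · exact Or.inl (Or.inr ⟨hab, hac⟩)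
        · refine Or.inl (Or.inl ⟨hab, hac, fun hbc => ?_⟩)
          rcases hbc.off_or_exists_mem (X := ∅) hbA (by simp) (by simp) with h' | ⟨y, hy, h'⟩
          · exact h h'
          · exact hab ((hA C hC y hy).full.trans h'.symm)
    have h2 : prob p (fun C => Separate r a b c C ∨ Pair r a b c C) ≤
        prob p (Separate r a b c) + prob p (Pair r a b c) :=
      prob_le_add hp fun C _ h => h
    linarith
  · refine le_trans (mul_le_mul_of_nonneg_right ?_ (prob_nonneg hp _))
      (prob_mul_prob_le_prob_pair hp haA hbA hcA hA)
    refine prob_add_le hp (fun C _ h => ⟨h.1, h.2.2⟩) (fun C _ h => ⟨h.2, fun h' => ?_⟩)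
      (fun C _ h h' => h.2.1 h'.1)
    exact h.2 (h.1.trans h'.symm)

end Connection

end Percolation
namespace Percolation

/-! ### Exploration of the cluster of `a` and the inequality for finitely many edges. -/

section Exploration

variable {V E : Type*} {r : E → Sym2 V} {C C' : E → Bool} {A : Set V} {u v x a b c : V} {e : E}

/-- Edges that touch `A` are irrelevant to connections off `A`. -/
theorem ConnOff.of_agree (h : ConnOff r C A u v) (hx : x ∈ A) (he : x ∈ r e)
    (hC : ∀ i, i ≠ e → C i = C' i) : ConnOff r C' A u v := by
  refine Relation.ReflTransGen.mono ?_ _ _ h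
  rintro y z ⟨hy, hz, i, hi, hr⟩
  refine ⟨hy, hz, i, ?_, hr⟩
  rw [← hC i, hi]
  rintro rfl
  rw [hr, Sym2.mem_iff] at he
  rcases he with rfl | rfl
  · exact hy hx
  · exact hz hx

/-- A connection that needs the edge `e` passes through both ends of `e`. -/
theorem ConnOff.of_agree_of_ends (h : ConnOff r C ∅ b c) (he : r e = s(x, v))
    (hC : ∀ i, i ≠ e → C i = C' i) :
    ConnOff r C' ∅ b c ∨ ConnOff r C' ∅ b x ∨ ConnOff r C' ∅ b v ∧ ConnOff r C' ∅ c x := by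
  induction h with
  | refl => exact Or.inl Relation.ReflTransGen.refl
  | @tail y z _ hyz ih =>
    obtain ⟨-, -, i, hi, hr⟩ := hyz
    by_cases hie : i = e
    · subst hie
      rw [he, Sym2.eq_iff] at hr
      rcases hr with ⟨rfl, rfl⟩ | ⟨rfl, rfl⟩
      · rcases ih with h | h | h
        · exact Or.inr (Or.inl h)
        · exact Or.inr (Or.inl h)
        · exact Or.inl h.1
      · rcases ih with h | h | h
        · exact Or.inr (Or.inr ⟨h, Relation.ReflTransGen.refl⟩)
        · exact Or.inr (Or.inl h)
        · exact Or.inr (Or.inr ⟨h.1, Relation.ReflTransGen.refl⟩)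
    · have hstep : OpenStep r C' ∅ y z := ⟨id, id, i, (hC i hie).symm.trans hi, hr⟩
      have hzy : ConnOff r C' ∅ z y := ConnOff.symm (Relation.ReflTransGen.single hstep)
      rcases ih with h | h | h
      · exact Or.inl (h.tail hstep)
      · exact Or.inr (Or.inl h)
      · exact Or.inr (Or.inr ⟨h.1, hzy.trans h.2⟩)

/-- The arithmetic at the stop, with `M`, `s`, `t` the probabilities of `a|b|c`, `ab|c`, `ac|b` and
`y`, `z` the two errors. With `S = s + t` and `m = ε/2 - M ≤ S`, eliminating `y` and `z` and adding
gives `ε²/2 ≤ S - 2m(S - m) + 2st`, hence `ε²/2 ≤ S + S²/2`. If `S < (ε²/2)(1 - M)`, then `M ≥ ε/2 -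
S` makes `1 - M` small enough to contradict this for `ε ≤ 1/2`. -/
theorem half_sq_mul_le_of_le {ε M s t y z : ℝ} (hε₀ : 0 < ε) (hε : ε ≤ 1 / 2) (hM₀ : 0 ≤ M)
    (hs : 0 ≤ s) (ht : 0 ≤ t) (hM : M < ε / 2) (hMst : ε / 2 ≤ M + (s + t))
    (h1 : ε ≤ M + s + y) (h2 : (M + t) * y ≤ t) (h3 : ε ≤ M + t + z) (h4 : (M + s) * z ≤ s) :
    ε ^ 2 / 2 * (1 - M) ≤ s + t := by
  have h5 : (M + t) * (ε - M - s) ≤ t :=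
    (mul_le_mul_of_nonneg_left (by linarith) (by linarith)).trans h2
  have h6 : (M + s) * (ε - M - t) ≤ s :=
    (mul_le_mul_of_nonneg_left (by linarith) (by linarith)).trans h4
  obtain ⟨S, hS⟩ : ∃ S, S = s + t := ⟨_, rfl⟩
  obtain ⟨m, hm⟩ : ∃ m, m = ε / 2 - M := ⟨_, rfl⟩
  have hM' : M = ε / 2 - m := by linarith
  rw [← hS] at hMst ⊢
  have h7 : ε ^ 2 / 2 ≤ S - 2 * m * (S - m) + S ^ 2 / 2 := by
    have : S ^ 2 / 2 - 2 * (s * t) = (s - t) ^ 2 / 2 := by rw [hS]; ring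
    have h8 : 0 ≤ (s - t) ^ 2 / 2 := by positivity
    subst hM'
    rw [hS] at this ⊢
    nlinarith
  have h8 : 0 ≤ 2 * m * (S - m) := mul_nonneg (by linarith) (by linarith)
  have h9 : ε ^ 2 / 2 ≤ S + S ^ 2 / 2 := by linarith
  by_contra hlt
  push Not at hlt
  have hS₀ : 0 ≤ S := by linarith
  have hε2 : 0 < ε ^ 2 / 2 := by positivity
  have hSle : S ≤ ε ^ 2 / 2 := by nlinarith
  have h10 : S < ε ^ 2 / 2 * (1 - ε / 2 + ε ^ 2 / 2) := by
    refine hlt.trans_le (mul_le_mul_of_nonneg_left (by linarith) hε2.le)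
  have h11 : S ^ 2 ≤ (ε ^ 2 / 2) ^ 2 := pow_le_pow_left₀ hS₀ hSle 2
  have h12 : 0 ≤ ε ^ 2 / 2 * (ε * (1 / 2 - ε)) :=
    mul_nonneg hε2.le (mul_nonneg hε₀.le (by linarith))
  nlinarith [pow_pos hε₀ 3, pow_pos hε₀ 4]

theorem prob_separate_comm [Fintype E] [DecidableEq E] (p : E → ℝ) :
    prob p (Separate r a b c) = prob p (Separate r a c b) := by
  congr 1
  ext C
  exact ⟨fun ⟨h1, h2, h3⟩ => ⟨h2, h1, fun h => h3 h.symm⟩,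
    fun ⟨h1, h2, h3⟩ => ⟨h2, h1, fun h => h3 h.symm⟩⟩

/-- The inequality in the course of an exploration of the cluster of `a`. The edges outside of `U`
have been revealed, and the vertices of `A` have been found to be connected to `a`. -/
theorem prob_conn_le_of_explored [Fintype E] [DecidableEq E] {ε : ℝ} (hε₀ : 0 < ε)
    (hε : ε ≤ 1 / 2) (U : Finset E) (p : E → ℝ) (A : Set V) (hp : ∀ e, 0 ≤ p e ∧ p e ≤ 1)
    (haA : a ∈ A) (hbA : b ∉ A) (hcA : c ∉ A)
    (hA : ∀ C : E → Bool, (∀ e, e ∉ U → p e = 1 → C e = true) → ∀ v ∈ A, ConnOff r C Aᶜ a v)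
    (hU : ∀ e, e ∉ U → ∃ x ∈ A, ∃ y, r e = s(x, y) ∧ (y ∉ A → p e = 0))
    (hW : ε ≤ prob p fun C => ¬ ConnOff r C A b c) (hM : ε / 2 ≤ prob p (Separate r a b c)) :
    ε ^ 2 / 2 * prob p (fun C => ConnOff r C ∅ a b ∨ ConnOff r C ∅ a c) ≤
      prob p (Pair r a b c) + prob p (Pair r a c b) := by
  -- Revealing an edge is encoded by setting its probability to 0 or 1 and removing it from `U`.
  induction U using Finset.strongInduction generalizing p A with
  | H U ih =>
  by_cases hcross : ∃ e ∈ U, ∃ x ∈ A, ∃ v, v ∉ A ∧ r e = s(x, v)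
  · obtain ⟨e, heU, x, hxA, v, hvA, hre⟩ := hcross
    obtain ⟨p₀, hp₀⟩ : ∃ q, q = Function.update p e 0 := ⟨_, rfl⟩
    obtain ⟨p₁, hp₁⟩ : ∃ q, q = Function.update p e 1 := ⟨_, rfl⟩
    have hp₀' : ∀ i, 0 ≤ p₀ i ∧ p₀ i ≤ 1 := fun i => by
      rw [hp₀]; exact update_mem_Icc hp e (by norm_num) i
    have hp₁' : ∀ i, 0 ≤ p₁ i ∧ p₁ i ≤ 1 := fun i => by
      rw [hp₁]; exact update_mem_Icc hp e (by norm_num) i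
    have hp₀e : p₀ e = 0 := by simp [hp₀]
    have hp₁e : p₁ e = 1 := by simp [hp₁]
    have hp₀i : ∀ i, i ≠ e → p₀ i = p i := fun i hi => by simp [hp₀, hi]
    have hp₁i : ∀ i, i ≠ e → p₁ i = p i := fun i hi => by simp [hp₁, hi]
    have hsplit : ∀ P, prob p P = p e * prob p₁ P + (1 - p e) * prob p₀ P := fun P => by
      rw [hp₀, hp₁]; exact prob_eq_update p e P
    have hflip : ∀ P : (E → Bool) → Prop,
        prob p₀ P = prob p₁ fun C => P (Function.update C e (!C e)) := fun P => by
      rw [hp₀, hp₁]; exact expect_update_zero p e _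
    have hopen : ∀ C, weight p₁ C ≠ 0 → C e = true := fun C hC => open_of_weight_ne_zero hC hp₁e
    have hagree : ∀ C : E → Bool, ∀ i, i ≠ e → C i = Function.update C e (!C e) i :=
      fun C i hi => by simp [hi]
    have hUe : ∀ i, i ∉ U → i ≠ e := fun i hi h => hi (h ▸ heU)
    -- The edge `e` touches `A`, so its state is irrelevant to connections off `A`.
    have heq : prob p₀ (fun C => ¬ ConnOff r C A b c) = prob p₁ fun C => ¬ ConnOff r C A b c := by
      rw [hflip]
      congr 1
      ext C
      rw [not_iff_not]
      exact ⟨fun h => h.of_agree hxA (by simp [hre]) fun i hi => (hagree C i hi).symm,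
        fun h => h.of_agree hxA (by simp [hre]) (hagree C)⟩
    have hW₀ : ε ≤ prob p₀ fun C => ¬ ConnOff r C A b c := by
      have := hsplit fun C => ¬ ConnOff r C A b c
      rw [← heq] at this
      linarith
    have hW₁ : ε ≤ prob p₁ fun C => ¬ ConnOff r C (insert v A) b c := by
      rw [heq] at hW₀
      exact hW₀.trans (prob_mono hp₁' fun C _ h h' => h (h'.mono le_rfl (Set.subset_insert v A)))
    have hA₀ : ∀ C : E → Bool, (∀ i, i ∉ U.erase e → p₀ i = 1 → C i = true) →
        ∀ w ∈ A, ConnOff r C Aᶜ a w := fun C hC => hA C fun i hi h =>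
      hC i (fun h' => hi (Finset.mem_of_mem_erase h')) ((hp₀i i (hUe i hi)).trans h)
    have hA₁ : ∀ C : E → Bool, (∀ i, i ∉ U.erase e → p₁ i = 1 → C i = true) →
        ∀ w ∈ insert v A, ConnOff r C (insert v A)ᶜ a w := by
      intro C hC
      have hold : ∀ w ∈ A, ConnOff r C (insert v A)ᶜ a w := fun w hw =>
        (hA C (fun i hi h => hC i (fun h' => hi (Finset.mem_of_mem_erase h'))
          ((hp₁i i (hUe i hi)).trans h)) w hw).mono le_rfl
          (Set.compl_subset_compl.2 (Set.subset_insert v A))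
      rintro w (rfl | hw)
      · exact (hold x hxA).tail ⟨by simp [hxA], by simp, e, hC e (by simp) hp₁e, hre⟩
      · exact hold w hw
    have hU₀ : ∀ i, i ∉ U.erase e → ∃ x ∈ A, ∃ y, r i = s(x, y) ∧ (y ∉ A → p₀ i = 0) := by
      intro i hi
      by_cases hie : i = e
      · exact ⟨x, hxA, v, hie ▸ hre, fun _ => hie ▸ hp₀e⟩
      · obtain ⟨x', hx', y, hr, hy⟩ := hU i fun h => hi (Finset.mem_erase.2 ⟨hie, h⟩)
        exact ⟨x', hx', y, hr, fun h => (hp₀i i hie).trans (hy h)⟩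
    have hU₁ : ∀ i, i ∉ U.erase e →
        ∃ x ∈ insert v A, ∃ y, r i = s(x, y) ∧ (y ∉ insert v A → p₁ i = 0) := by
      intro i hi
      by_cases hie : i = e
      · exact ⟨x, Or.inr hxA, v, hie ▸ hre, fun h => absurd (Set.mem_insert v A) h⟩
      · obtain ⟨x', hx', y, hr, hy⟩ := hU i fun h => hi (Finset.mem_erase.2 ⟨hie, h⟩)
        exact ⟨x', Or.inr hx', y, hr, fun h => (hp₁i i hie).trans (hy fun h' => h (Or.inr h'))⟩
    have hM₁₀ : prob p₁ (Separate r a b c) ≤ prob p₀ (Separate r a b c) := by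
      rw [hflip]
      refine prob_mono hp₁' fun C hC h => ?_
      have hle : Function.update C e (!C e) ≤ C := by
        rw [hopen C hC]
        exact update_le_self_iff.2 (by simp [hopen C hC])
      exact ⟨fun h' => h.1 (h'.mono hle le_rfl), fun h' => h.2.1 (h'.mono hle le_rfl),
        fun h' => h.2.2 (h'.mono hle le_rfl)⟩
    have hM₀ : ε / 2 ≤ prob p₀ (Separate r a b c) := by
      have := hsplit (Separate r a b c)
      have := mul_nonneg (hp e).1 (sub_nonneg.2 hM₁₀)
      linarith
    -- Opening `e` merges the cluster of `a`, which contains `x`, with that of `v`. Starting from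
    -- `a|b|c`, this adds at most one of `b` and `c` to the cluster of `a` and cannot join them to
    -- each other alone.
    have hM₁ : ε / 2 ≤ prob p₁ (Separate r a b c) +
        (prob p₁ (Pair r a b c) + prob p₁ (Pair r a c b)) := by
      refine hM₀.trans ?_
      rw [hflip]
      refine (prob_le_add hp₁' (Q := Separate r a b c)
        (R := fun C => Pair r a b c C ∨ Pair r a c b C) fun C hC h => ?_).trans
        (add_le_add_right (prob_le_add hp₁' fun C _ h => h) _)
      have hax : ConnOff r (Function.update C e (!C e)) ∅ a x := by
        refine (hA _ (fun i hi h1 => ?_) x hxA).full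
        rw [← hagree C i (hUe i hi)]
        exact open_of_weight_ne_zero hC ((hp₁i i (hUe i hi)).trans h1)
      have hbc : ¬ ConnOff r C ∅ b c := fun hbc => by
        rcases hbc.of_agree_of_ends hre (hagree C) with h' | h' | h'
        · exact h.2.2 h'
        · exact h.1 (hax.trans h'.symm)
        · exact h.2.1 (hax.trans h'.2.symm)
      by_cases hab : ConnOff r C ∅ a b
      · exact Or.inr (Or.inl ⟨hab, fun hac => hbc (hab.symm.trans hac)⟩)
      · by_cases hac : ConnOff r C ∅ a c
        · exact Or.inr (Or.inr ⟨hac, hab⟩)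
        · exact Or.inl ⟨hab, hac, hbc⟩
    have h₀ := ih (U.erase e) (Finset.erase_ssubset heU) p₀ A hp₀' haA hbA hcA hA₀ hU₀ hW₀ hM₀
    have hsupp₁ : ∀ C, weight p₁ C ≠ 0 → ∀ w ∈ insert v A, ConnOff r C (insert v A)ᶜ a w :=
      fun C hC => hA₁ C fun i _ h => open_of_weight_ne_zero hC h
    have h₁ : ε ^ 2 / 2 * prob p₁ (fun C => ConnOff r C ∅ a b ∨ ConnOff r C ∅ a c) ≤
        prob p₁ (Pair r a b c) + prob p₁ (Pair r a c b) := by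
      have hQ : prob p₁ (fun C => ConnOff r C ∅ a b ∨ ConnOff r C ∅ a c) ≤
          1 - prob p₁ (Separate r a b c) := by
        have : prob p₁ (fun C => ConnOff r C ∅ a b ∨ ConnOff r C ∅ a c) +
            prob p₁ (Separate r a b c) ≤ prob p₁ fun _ => True :=
          prob_add_le hp₁' (fun _ _ _ => trivial) (fun _ _ _ => trivial)
            fun C _ h h' => h.elim h'.1 h'.2.1
        linarith [prob_le_one hp₁' fun _ => True]
      -- If `b` or `c` has been reached, `a|b|c` is impossible, so `hM₁` alone gives `ε/2 ≥ ε²/2`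
      -- for the two pair events.
      by_cases hv : b ∈ insert v A ∨ c ∈ insert v A
      · have hM₁' : prob p₁ (Separate r a b c) ≤ 0 := by
          rw [← expect_const p₁ 0]
          refine expect_mono hp₁' fun C hC => ?_
          rw [if_neg]
          intro h
          rcases hv with hv | hv
          · exact h.1 (hsupp₁ C hC b hv).full
          · exact h.2.1 (hsupp₁ C hC c hv).full
        have := mul_le_mul_of_nonneg_left
          (prob_le_one hp₁' fun C => ConnOff r C ∅ a b ∨ ConnOff r C ∅ a c)
          (by positivity : (0 : ℝ) ≤ ε ^ 2 / 2)
        nlinarith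
      · push Not at hv
        -- Either the exploration goes on with `v` added to `A`, or it stops here because `M` fell
        -- below `ε/2`.
        by_cases hlt : ε / 2 ≤ prob p₁ (Separate r a b c)
        · exact ih (U.erase e) (Finset.erase_ssubset heU) p₁ (insert v A) hp₁' (Or.inr haA) hv.1
            hv.2 hA₁ hU₁ hW₁ hlt
        · obtain ⟨t, ht, ht'⟩ :=
            exists_prob_not_connOff_le (A := insert v A) hp₁' (Or.inr haA) hv.1 hv.2 hsupp₁
          obtain ⟨s, hs, hs'⟩ :=
            exists_prob_not_connOff_le (A := insert v A) hp₁' (Or.inr haA) hv.2 hv.1 hsupp₁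
          rw [← prob_separate_comm] at hs hs'
          have hcomm : (fun C => ¬ ConnOff r C (insert v A) c b) =
              fun C => ¬ ConnOff r C (insert v A) b c := by
            ext C
            exact not_congr ⟨ConnOff.symm, ConnOff.symm⟩
          rw [hcomm] at hs
          exact (mul_le_mul_of_nonneg_left hQ (by positivity)).trans
            (half_sq_mul_le_of_le hε₀ hε (prob_nonneg hp₁' _) (prob_nonneg hp₁' _)
              (prob_nonneg hp₁' _) (not_le.1 hlt) hM₁ (hW₁.trans ht) ht' (hW₁.trans hs) hs')
    rw [hsplit fun C => ConnOff r C ∅ a b ∨ ConnOff r C ∅ a c, hsplit (Pair r a b c),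
      hsplit (Pair r a c b)]
    have h₁' := mul_le_mul_of_nonneg_left h₁ (hp e).1
    have h₀' := mul_le_mul_of_nonneg_left h₀ (sub_nonneg.2 (hp e).2)
    linarith
  -- No unrevealed edge leaves `A`, and the revealed ones that do are closed: the cluster of `a`
  -- lies in `A` and misses `b` and `c`.
  · have hQ : prob p (fun C => ConnOff r C ∅ a b ∨ ConnOff r C ∅ a c) ≤ 0 := by
      rw [← expect_const p 0]
      refine expect_mono hp fun C hC => ?_
      rw [if_neg]
      have hclosed : ∀ w, ConnOff r C ∅ a w → w ∈ A := by
        intro w hw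
        induction hw with
        | refl => exact haA
        | @tail y z _ hyz ihy =>
          obtain ⟨-, -, i, hi, hr⟩ := hyz
          by_contra hz
          have hiU : i ∉ U := fun hiU => hcross ⟨i, hiU, y, ihy, z, hz, hr⟩
          obtain ⟨x, hx, y', hr', hy'⟩ := hU i hiU
          have : p i = 0 := by
            refine hy' fun hy'A => hz ?_
            rw [hr, Sym2.eq_iff] at hr'
            rcases hr' with ⟨-, rfl⟩ | ⟨-, rfl⟩
            · exact hy'A
            · exact hx
          rw [closed_of_weight_ne_zero hC this] at hi
          exact Bool.false_ne_true hi
      rintro (h | h)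
      · exact hbA (hclosed b h)
      · exact hcA (hclosed c h)
    have := prob_nonneg hp (Pair r a b c)
    have := prob_nonneg hp (Pair r a c b)
    nlinarith [sq_nonneg ε]

/-- The quantitative inequality for finitely many edges. -/
theorem pow_three_div_two_le [Fintype E] [DecidableEq E] {ε : ℝ} {p : E → ℝ}
    (hp : ∀ e, 0 ≤ p e ∧ p e ≤ 1) (hab : a ≠ b) (hac : a ≠ c) (hε₀ : 0 < ε)
    (hM : ε ≤ prob p (Separate r a b c))
    (hN : ε ≤ prob p fun C => ConnOff r C ∅ a b ∧ ConnOff r C ∅ b c) :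
    ε ^ 3 / 2 ≤ prob p (Pair r a b c) + prob p (Pair r a c b) := by
  have hsum : prob p (Separate r a b c) +
      prob p (fun C => ConnOff r C ∅ a b ∧ ConnOff r C ∅ b c) ≤ prob p fun _ => True :=
    prob_add_le hp (fun _ _ _ => trivial) (fun _ _ _ => trivial) fun C _ h h' => h.1 h'.1
  have hone := prob_le_one hp fun _ => True
  have key := prob_conn_le_of_explored (r := r) (a := a) (b := b) (c := c) hε₀ (by linarith)
    Finset.univ p {a} hp rfl (fun h => hab h.symm) (fun h => hac h.symm)
    (fun C _ v hv => by rw [hv]; exact Relation.ReflTransGen.refl)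
    (fun e he => absurd (Finset.mem_univ e) he)
    (hM.trans (prob_mono hp fun C _ h h' => h.2.2 h'.full)) (by linarith)
  have hQ : ε ≤ prob p fun C => ConnOff r C ∅ a b ∨ ConnOff r C ∅ a c :=
    hN.trans (prob_mono hp fun C _ h => Or.inl h.1)
  have := mul_le_mul_of_nonneg_left hQ (by positivity : (0 : ℝ) ≤ ε ^ 2 / 2)
  calc ε ^ 3 / 2 = ε ^ 2 / 2 * ε := by ring
    _ ≤ _ := this.trans key

end Exploration

end Percolation
namespace Percolation

open MeasureTheory ProbabilityTheory Filter Topology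

/-! ### Countability of the graph. -/

section Countable

variable {V : Type*} {G : SimpleGraph V}

/-- A locally finite connected graph has countably many vertices. -/
theorem countable_of_locallyFinite [G.LocallyFinite] (hG : G.Connected) : Countable V := by
  obtain ⟨a⟩ := hG.nonempty
  have h : ∀ (n : ℕ) (u : V), {v | ∃ w : G.Walk u v, w.length = n}.Countable := by
    intro n
    induction n with
    | zero =>
      refine fun u => (Set.countable_singleton u).mono ?_
      rintro v ⟨w, hw⟩
      exact (SimpleGraph.Walk.eq_of_length_eq_zero hw).symm
    | succ n ih =>
      refine fun u => ((Set.toFinite (G.neighborSet u)).countable.biUnion fun x _ => ih x).mono ?_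
      rintro v ⟨w, hw⟩
      cases w with
      | nil => simp at hw
      | cons hux w => exact Set.mem_biUnion hux ⟨w, by simpa using hw⟩
  refine Set.countable_univ_iff.1 ((Set.countable_iUnion fun n => h n a).mono fun v _ => ?_)
  obtain ⟨w⟩ := hG.preconnected a v
  exact Set.mem_iUnion.2 ⟨w.length, w, rfl⟩

end Countable

/-! ### Passage from finite edge sets to the whole graph. -/

section Approximation

variable {V : Type*} (G : SimpleGraph V)

/-- The vertices `u` and `v` are connected by open edges that belong to `F`. -/
def ConnIn (F : Finset G.edgeSet) (u v : V) (C : Configuration G) : Prop :=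
  ConnOff (fun e : F => (e : G.edgeSet).1) (F.restrict C) ∅ u v

variable {G}

theorem cluster_eq_iff_connOff {C : Configuration G} {u v : V} :
    cluster G C u = cluster G C v ↔ ConnOff (fun e : G.edgeSet => e.1) C ∅ u v := by
  rw [cluster, cluster, SimpleGraph.ConnectedComponent.eq, SimpleGraph.reachable_iff_reflTransGen]
  constructor
  · refine fun h => Relation.ReflTransGen.mono ?_ _ _ h
    rintro x y hxy
    obtain ⟨⟨h, hC⟩, -⟩ := (SimpleGraph.fromEdgeSet_adj _).1 hxy
    exact ⟨id, id, ⟨s(x, y), h⟩, hC, rfl⟩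
  · refine fun h => Relation.ReflTransGen.mono ?_ _ _ h
    rintro x y ⟨-, -, ⟨e, he⟩, hC, rfl⟩
    exact (SimpleGraph.fromEdgeSet_adj _).2 ⟨⟨he, hC⟩, G.ne_of_adj he⟩

theorem ConnIn.mono {F F' : Finset G.edgeSet} {u v : V} {C : Configuration G}
    (h : ConnIn G F u v C) (hF : F ⊆ F') : ConnIn G F' u v C := by
  refine Relation.ReflTransGen.mono ?_ _ _ h
  rintro x y ⟨h1, h2, e, he, hr⟩
  exact ⟨h1, h2, ⟨e, hF e.2⟩, he, hr⟩

theorem ConnIn.cluster_eq {F : Finset G.edgeSet} {u v : V} {C : Configuration G}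
    (h : ConnIn G F u v C) : cluster G C u = cluster G C v := by
  refine cluster_eq_iff_connOff.2 (Relation.ReflTransGen.mono ?_ _ _ h)
  rintro x y ⟨h1, h2, e, he, hr⟩
  exact ⟨h1, h2, e, he, hr⟩

/-- Along an exhaustion by finite sets of edges, connections are eventually seen. -/
theorem eventually_connIn_iff {F : ℕ → Finset G.edgeSet} (hF : Monotone F)
    (hF' : ∀ e, ∃ n, e ∈ F n) (u v : V) (C : Configuration G) :
    ∀ᶠ n in atTop, ConnIn G (F n) u v C ↔ cluster G C u = cluster G C v := by
  by_cases h : cluster G C u = cluster G C v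
  · have : ∃ n, ConnIn G (F n) u v C := by
      have h' := cluster_eq_iff_connOff.1 h
      clear h
      induction h' with
      | refl => exact ⟨0, Relation.ReflTransGen.refl⟩
      | @tail y z _ hyz ih =>
        obtain ⟨n, hn⟩ := ih
        obtain ⟨h1, h2, e, he, hr⟩ := hyz
        obtain ⟨m, hm⟩ := hF' e
        refine ⟨max n m, (hn.mono (hF (le_max_left n m))).tail ⟨h1, h2, ?_⟩⟩
        exact ⟨⟨e, hF (le_max_right n m) hm⟩, he, hr⟩
    obtain ⟨n, hn⟩ := this
    filter_upwards [eventually_ge_atTop n] with m hm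
    exact ⟨fun _ => h, fun _ => hn.mono (hF hm)⟩
  · exact Eventually.of_forall fun n => ⟨fun h' => absurd h'.cluster_eq h, fun h' => absurd h' h⟩

/-- Events that depend on finitely many edges have the same probability in the finite model. -/
theorem bernoulliPercolation_real_restrict (p : G.edgeSet → unitInterval)
    (F : Finset G.edgeSet) [DecidableEq F] (P : (F → Bool) → Prop) :
    (bernoulliPercolation G p).real {C | P (F.restrict C)} =
      prob (fun e : F => (p e : ℝ)) P := by
  classical
  have hP : MeasurableSet {x : F → Bool | P x} := (Set.toFinite _).measurableSet
  have h1 : (bernoulliPercolation G p).real {C | P (F.restrict C)} =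
      (Measure.pi fun e : F => bernoulliMeasure true false (p e)).real {x | P x} := by
    rw [measureReal_def, measureReal_def, bernoulliPercolation,
      ← Measure.infinitePi_map_restrict (fun e => bernoulliMeasure true false (p e)),
      Measure.map_apply (Finset.measurable_restrict F) hP]
    rfl
  have h2 : {x : F → Bool | P x} = (Finset.univ.filter P : Finset (F → Bool)) := by
    simp
  rw [h1, h2, ← sum_measureReal_singleton, prob, expect, Finset.sum_filter]
  refine Finset.sum_congr rfl fun C _ => ?_
  have h3 : (Measure.pi fun e : F => bernoulliMeasure true false (p e)).real {C} =
      weight (fun e : F => (p e : ℝ)) C := by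
    rw [measureReal_def, Measure.pi_singleton, ENNReal.toReal_prod, weight]
    refine Finset.prod_congr rfl fun e _ => ?_
    rw [← measureReal_def]
    cases C e <;> simp
  rw [h3]
  split_ifs <;> simp

theorem measurableSet_restrict (F : Finset G.edgeSet) (P : (F → Bool) → Prop) :
    MeasurableSet {C : Configuration G | P (F.restrict C)} :=
  Finset.measurable_restrict F (Set.toFinite {x : F → Bool | P x}).measurableSet

theorem exists_exhaustion (α : Type*) [Countable α] :
    ∃ F : ℕ → Finset α, Monotone F ∧ ∀ x, ∃ n, x ∈ F n := by
  obtain ⟨f, hf⟩ := exists_injective_nat α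
  refine ⟨fun n => ((Set.finite_Iic n).preimage hf.injOn).toFinset, fun m n h x hx => ?_,
    fun x => ⟨f x, by simp⟩⟩
  simp only [Set.Finite.mem_toFinset, Set.mem_preimage, Set.mem_Iic] at hx ⊢
  exact hx.trans h

/-- The quantitative inequality for locally finite connected graphs. -/
theorem pow_three_div_two_le_add [G.LocallyFinite] (hG : G.Connected)
    (p : G.edgeSet → unitInterval) {a b c : V} (hab : a ≠ b) (hac : a ≠ c) {ε : ℝ} (hε : 0 < ε)
    (hN : ε ≤ (bernoulliPercolation G p).real (allTogether G a b c))
    (hM : ε ≤ (bernoulliPercolation G p).real (allSeparate G a b c)) :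
    ε ^ 3 / 2 ≤ (bernoulliPercolation G p).real (pairApart G a b c) +
      (bernoulliPercolation G p).real (pairApart G a c b) := by
  classical
  have : Countable V := countable_of_locallyFinite hG
  have : Countable (Sym2 V) := inferInstanceAs (Countable (Quot _))
  obtain ⟨F, hF, hF'⟩ := exists_exhaustion G.edgeSet
  have : IsProbabilityMeasure (bernoulliPercolation G p) := by
    unfold bernoulliPercolation; infer_instance
  have hlim : ∀ (A : Set (Configuration G)) (P : (n : ℕ) → (F n → Bool) → Prop),
      (∀ C, ∀ᶠ n in atTop, P n ((F n).restrict C) ↔ C ∈ A) →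
      Tendsto (fun n => prob (fun e : F n => (p e : ℝ)) (P n)) atTop
        (𝓝 ((bernoulliPercolation G p).real A)) := by
    intro A P h
    simp only [← bernoulliPercolation_real_restrict]
    exact (ENNReal.tendsto_toReal (measure_ne_top _ _)).comp
      (tendsto_measure_of_tendsto_indicator_of_isFiniteMeasure atTop _
        (fun n => measurableSet_restrict (F n) (P n)) h)
  have conn := eventually_connIn_iff hF hF'
  let r : (n : ℕ) → F n → Sym2 V := fun n e => (e : G.edgeSet).1
  have hlimN := hlim (allTogether G a b c)
    (fun n C => ConnOff (r n) C ∅ a b ∧ ConnOff (r n) C ∅ b c) fun C => by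
      filter_upwards [conn a b C, conn b c C] with n h1 h2
      exact and_congr h1 h2
  have hlimM := hlim (allSeparate G a b c) (fun n => Separate (r n) a b c) fun C => by
      filter_upwards [conn a b C, conn a c C, conn b c C] with n h1 h2 h3
      exact and_congr (not_congr h1) (and_congr (not_congr h2) (not_congr h3))
  have hlimB := hlim (pairApart G a b c) (fun n => Pair (r n) a b c) fun C => by
      filter_upwards [conn a b C, conn a c C] with n h1 h2
      exact and_congr h1 (not_congr h2)
  have hlimC := hlim (pairApart G a c b) (fun n => Pair (r n) a c b) fun C => by
      filter_upwards [conn a b C, conn a c C] with n h1 h2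
      exact and_congr h2 (not_congr h1)
  -- The finite inequality is applied with `ε` replaced by the minimum of the two probabilities at
  -- level `n`, since these need not reach `ε` themselves; the cube passes to the limit.
  have hlimMN := hlimM.min hlimN
  have hpos : ε ≤ min ((bernoulliPercolation G p).real (allSeparate G a b c))
      ((bernoulliPercolation G p).real (allTogether G a b c)) := le_min hM hN
  refine le_trans (by gcongr) (le_of_tendsto_of_tendsto ((hlimMN.pow 3).div_const 2)
    (hlimB.add hlimC) ?_)
  filter_upwards [hlimMN.eventually_const_lt (hε.trans_le hpos)] with n hn
  exact pow_three_div_two_le (fun e => (p e).2) hab hac hn (min_le_left _ _) (min_le_right _ _)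

end Approximation

end Percolation

theorem mainTheorem3 (ε : ℝ) (hε : 0 < ε) :
    ∃ δ : ℝ, 0 < δ ∧ δ = ε ^ 3 / 4 ∧
      ∀ (V : Type*) (G : SimpleGraph V) [G.LocallyFinite], G.Connected →
        ∀ (p : G.edgeSet → unitInterval) (a b c : V), a ≠ b → a ≠ c → b ≠ c →
          (Percolation.bernoulliPercolation G p).real (Percolation.pairApart G a b c) < δ →
          (Percolation.bernoulliPercolation G p).real (Percolation.pairApart G a c b) < δ →
            (Percolation.bernoulliPercolation G p).real (Percolation.allTogether G a b c) < ε ∨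
            (Percolation.bernoulliPercolation G p).real (Percolation.allSeparate G a b c) < ε := by
  -- The two pair events have total probability at least `ε³/2`, so they cannot both be below half
  -- of it.
  refine ⟨ε ^ 3 / 4, by positivity, rfl, ?_⟩
  intro V G _ hG p a b c hab hac _ h1 h2
  by_contra! h
  linarith [Percolation.pow_three_div_two_le_add hG p hab hac hε h.1 h.2]
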